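/- Let $N\ge 2$, let $\mathbb D^N$ be the closed unit disk in $\mathbb R^N$, and let $k\in\{2,3,\dots,\infty\}$. For a $C^k$ Riemannian metric $g$ on $\mathbb D^N$ ($C^k$ up to the boundary), an *O--T chord* is a nonconstant $g$-geodesic $\gamma\colon[0,b]\to\mathbb D^N$, $b>0$, such that $\gamma(0),\gamma(b)\in\partial\mathbb D^N$, $\dot\gamma(0)$ is $g$-orthogonal to $\partial\mathbb D^N$ at $\gamma(0)$, and $\dot\gamma(b)$ is tangent to $\partial\mathbb D^N$ at $\gamma(b)$. Equip the set of $C^k$ Riemannian metrics on $\mathbb D^N$ with the $C^2$ topology (uniform convergence on $\mathbb D^N$ of the metric coefficients and of their derivatives up to order $2$). Then the set of metrics that admit an O--T chord has nonempty interior. Hence the absence of O--T chords is not a generic condition: the set of metrics without O--T chords is not dense. -/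

import Mathlib

open scoped ContDiff UniformConvergence

noncomputable section

/-- The closed `N`-dimensional unit disk in Euclidean space `ℝ^N`. -/
def disk (N : ℕ) : Set (EuclideanSpace ℝ (Fin N)) :=
  Metric.closedBall 0 1

/-- A Riemannian metric of class `C^k` on the closed unit disk: a symmetric positive definite
bilinear form `form x` at each point `x` of the disk, which depends on `x` in a `C^k` way up to the
boundary. Outside the disk `form` is set to `0`, so that two metrics are equal as soon as they agree
on the disk. -/
structure DiskMetric (N : ℕ) (k : ℕ∞) where
  form : EuclideanSpace ℝ (Fin N) →
    EuclideanSpace ℝ (Fin N) →L[ℝ] EuclideanSpace ℝ (Fin N) →L[ℝ] ℝ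
  contDiffOn : ContDiffOn ℝ k form (disk N)
  symm : ∀ x ∈ disk N, ∀ v w, form x v w = form x w v
  pos : ∀ x ∈ disk N, ∀ v, v ≠ 0 → 0 < form x v v
  eq_zero : ∀ x, x ∉ disk N → form x = 0

namespace DiskMetric

variable {N : ℕ} {k : ℕ∞}

/-- The `C^2` topology on the set of metrics: uniform convergence on the disk of the metric and
of its derivatives of order `1` and `2`. -/
instance c2Topology : TopologicalSpace (DiskMetric N k) :=
  ⨅ j : Fin 3, TopologicalSpace.induced
    (fun g : DiskMetric N k =>
      UniformFun.ofFun fun x : disk N => iteratedFDerivWithin ℝ (j : ℕ) g.form (disk N) x)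
    inferInstance

/-- The Christoffel symbols of the first kind of the Levi-Civita connection of `g`,
`Γ_x(u, v; w) = (1/2) (∂_u g (v, w) + ∂_v g (u, w) - ∂_w g (u, v))`, so that
`g (∇_u V, w) = g (∂_u V, w) + Γ (u, V; w)`. -/
def christoffel (g : DiskMetric N k) (x u v w : EuclideanSpace ℝ (Fin N)) : ℝ :=
  (1 / 2) * (fderivWithin ℝ g.form (disk N) x u v w + fderivWithin ℝ g.form (disk N) x v u w
    - fderivWithin ℝ g.form (disk N) x w u v)

/-- `γ : [0, b] → disk` is a geodesic segment of `g` (affinely parametrized): it is of class `C^2`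
and `∇_{γ'} γ' = 0` on `[0, b]`. -/
structure IsGeodesicSegment (g : DiskMetric N k) (b : ℝ)
    (γ : ℝ → EuclideanSpace ℝ (Fin N)) : Prop where
  pos_length : 0 < b
  contDiffOn : ContDiffOn ℝ 2 γ (Set.Icc 0 b)
  mapsTo : Set.MapsTo γ (Set.Icc 0 b) (disk N)
  geodesic_eq : ∀ t ∈ Set.Icc 0 b, ∀ w : EuclideanSpace ℝ (Fin N),
    g.form (γ t) (derivWithin (derivWithin γ (Set.Icc 0 b)) (Set.Icc 0 b) t) w
      + g.christoffel (γ t) (derivWithin γ (Set.Icc 0 b) t) (derivWithin γ (Set.Icc 0 b) t) w = 0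

/-- `γ : [0, b] → disk` is an orthogonal-tangent chord of `g`: a nonconstant geodesic segment with
both endpoints on the boundary sphere, which starts `g`-orthogonally to the sphere and ends tangent
to it. The tangent space of the sphere at `p` is `{w | ⟪p, w⟫ = 0}`. -/
structure IsOTChord (g : DiskMetric N k) (b : ℝ)
    (γ : ℝ → EuclideanSpace ℝ (Fin N)) : Prop where
  isGeodesicSegment : g.IsGeodesicSegment b γ
  nonconstant : derivWithin γ (Set.Icc 0 b) 0 ≠ 0
  start_mem : γ 0 ∈ Metric.sphere (0 : EuclideanSpace ℝ (Fin N)) 1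
  end_mem : γ b ∈ Metric.sphere (0 : EuclideanSpace ℝ (Fin N)) 1
  orthogonal : ∀ w : EuclideanSpace ℝ (Fin N), inner ℝ (γ 0) w = 0 →
    g.form (γ 0) (derivWithin γ (Set.Icc 0 b) 0) w = 0
  tangent : inner ℝ (γ b) (derivWithin γ (Set.Icc 0 b) b) = 0

/-- The metric `g` admits an orthogonal-tangent chord. -/
def AdmitsOTChord (g : DiskMetric N k) : Prop :=
  ∃ (b : ℝ) (γ : ℝ → EuclideanSpace ℝ (Fin N)), g.IsOTChord b γ

end DiskMetric

end

/-!
The idea is to find a one-parameter family of normal geodesics which, for purely topological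
reasons, has to contain one that is tangent to the sphere, and to do so in a way that survives
small perturbations of the metric.

The model metric is the pullback of a flat metric under the shear `x ↦ x + x_i ^ 2 e_j`
(`shearMetric`). Its geodesics are parabolas with acceleration `-2 v_i ^ 2 e_j`
(`accel_shearMetric`, `hasDerivAt_parabola`), and the one that leaves `-e_i` orthogonally to the
sphere is `y = 1 - x ^ 2`, which touches the unit circle from inside at its vertex `e_j`. Move the
starting point along a short arc of the circle through `-e_i`. The geodesics that start on one side
of `-e_i` cross the circle near `e_j` and return to the disk, those that start on the other side
pass below it. For this the additional term `dy_i ^ 2` in the flat metric matters: without it, `e_j`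
would be a focal point of the arc, and the touching geodesic would not separate the two kinds.

In the `C^2` topology, the geodesic equation and the inward normals of nearby metrics are uniformly
close to those of the model (`eventually_geodesicField_dist_le`). Geodesics of a perturbed metric
may leave the disk, where the metric is undefined. The geodesic field is therefore precomposed with
radial retractions (`geodesicField`), which keeps it Lipschitz and gives it integral curves for all
times. As the acceleration of the model does not depend on the base point, the model parabolas stay
integral curves outside the disk. Grönwall's inequality (`eventually_integralCurve_dist_le`) keeps
the perturbed family close to the parabolas. The function `1 - ‖x‖ ^ 2` along the perturbed family is
then still negative somewhere at one end of the arc and positive at the other, and by connectedness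
of the arc some curve of the family is nonnegative with an interior zero
(`exists_touching_parameter`). Up to that zero the curve stays in the disk, so it is a geodesic, and
at the zero, an interior minimum, it is tangent to the sphere.
-/

set_option maxSynthPendingDepth 3

/-! ### Retractions, autonomous flows and touching parameters -/

section Analysis

open Set Metric

variable {V : Type*} [NormedAddCommGroup V] [NormedSpace ℝ V]

/-- The radial retraction of a normed space onto the closed ball of radius `R` around `0`
(meaningful for `0 < R`): it fixes the ball and sends every other point to the sphere. -/
noncomputable def radialRetraction (R : ℝ) (x : V) : V := (R / max R ‖x‖) • x

lemma norm_radialRetraction_le {R : ℝ} (hR : 0 < R) (x : V) : ‖radialRetraction R x‖ ≤ R := by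
  have hm : 0 < max R ‖x‖ := lt_max_of_lt_left hR
  rw [radialRetraction, norm_smul, Real.norm_of_nonneg (by positivity), div_mul_eq_mul_div,
    div_le_iff₀ hm]
  exact mul_le_mul_of_nonneg_left (le_max_right _ _) hR.le

lemma radialRetraction_of_norm_le {R : ℝ} (hR : 0 < R) {x : V} (hx : ‖x‖ ≤ R) :
    radialRetraction R x = x := by
  rw [radialRetraction, max_eq_left hx, div_self hR.ne', one_smul]

lemma lipschitzWith_radialRetraction {R : ℝ} (hR : 0 < R) :
    LipschitzWith 2 (radialRetraction R : V → V) := by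
  refine LipschitzWith.of_dist_le_mul fun x y => ?_
  simp only [dist_eq_norm, radialRetraction]
  set a := max R ‖x‖
  set b := max R ‖y‖
  have ha : 0 < a := lt_max_of_lt_left hR
  have hb : 0 < b := lt_max_of_lt_left hR
  have hab : |b - a| ≤ ‖x - y‖ := by
    refine (abs_max_sub_max_le_max R ‖y‖ R ‖x‖).trans ?_
    rw [sub_self, abs_zero, max_eq_right (abs_nonneg _), abs_sub_comm]
    exact abs_norm_sub_norm_le x y
  have h1 : (R / a) • x - (R / b) • y = (R / a) • (x - y) + (R / a - R / b) • y := by module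
  have h2 : ‖(R / a) • (x - y)‖ ≤ ‖x - y‖ := by
    rw [norm_smul, Real.norm_of_nonneg (by positivity)]
    exact mul_le_of_le_one_left (norm_nonneg _) ((div_le_one ha).2 (le_max_left _ _))
  have h3 : ‖(R / a - R / b) • y‖ ≤ ‖x - y‖ := by
    have e : R / a - R / b = R / a * ((b - a) / b) := by field_simp
    rw [norm_smul, e, norm_mul, Real.norm_of_nonneg (by positivity : (0:ℝ) ≤ R / a),
      Real.norm_eq_abs, abs_div, abs_of_pos hb]
    have h4 : ‖y‖ / b ≤ 1 := (div_le_one hb).2 (le_max_right _ _)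
    have h5 : R / a ≤ 1 := (div_le_one ha).2 (le_max_left _ _)
    calc R / a * (|b - a| / b) * ‖y‖ = R / a * |b - a| * (‖y‖ / b) := by ring
      _ ≤ 1 * |b - a| * 1 := by gcongr
      _ ≤ ‖x - y‖ := by simpa using hab
  rw [h1]
  refine (norm_add_le _ _).trans ?_
  push_cast
  linarith

/-- A bounded Lipschitz vector field has integral curves of any prescribed length. -/
lemma exists_hasDerivWithinAt_Icc_of_bounded [CompleteSpace V] {F : V → V} {K : NNReal}
    (hF : LipschitzWith K F) {M : ℝ} (hM : ∀ z, ‖F z‖ ≤ M) {T : ℝ} (hT : 0 ≤ T) (z₀ : V) :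
    ∃ γ : ℝ → V, γ 0 = z₀ ∧ ∀ t ∈ Icc 0 T, HasDerivWithinAt γ (F (γ t)) (Icc 0 T) t := by
  have hM0 : 0 ≤ M := (norm_nonneg _).trans (hM 0)
  have hpl : IsPicardLindelof (fun _ => F) (tmin := 0) (tmax := T) ⟨0, le_rfl, hT⟩ z₀
      ⟨M * T, by positivity⟩ 0 ⟨M, hM0⟩ K := by
    refine IsPicardLindelof.of_time_independent (fun x _ => hM x) hF.lipschitzOnWith ?_
    simp only [sub_zero, sub_self, max_eq_left hT, NNReal.coe_zero]
    exact le_rfl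
  exact hpl.exists_eq_forall_mem_Icc_hasDerivWithinAt₀

lemma HasDerivWithinAt.Ici_of_Icc {γ : ℝ → V} {γ' : V} {a b t : ℝ}
    (h : HasDerivWithinAt γ γ' (Icc a b) t) (ht : t ∈ Ico a b) :
    HasDerivWithinAt γ γ' (Ici t) t := by
  refine (h.mono (Icc_subset_Icc_left ht.1)).mono_of_mem_nhdsWithin ?_
  exact Icc_mem_nhdsGE ht.2

/-- Integral curves of one Lipschitz field which start at points depending continuously on a
parameter are jointly continuous in the parameter and in time. -/
lemma continuousOn_uncurry_of_integralCurves {F : V → V} {K : NNReal} (hF : LipschitzWith K F)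
    {S : Set ℝ} {T : ℝ} {γ : ℝ → ℝ → V}
    (hγ : ∀ s ∈ S, ∀ t ∈ Icc 0 T, HasDerivWithinAt (γ s) (F (γ s t)) (Icc 0 T) t)
    (h0 : ContinuousOn (fun s => γ s 0) S) :
    ContinuousOn (fun z : ℝ × ℝ => γ z.1 z.2) (S ×ˢ Icc 0 T) := by
  have hgr : ∀ s ∈ S, ∀ s' ∈ S, ∀ t ∈ Icc 0 T,
      dist (γ s t) (γ s' t) ≤ dist (γ s 0) (γ s' 0) * Real.exp (K * T) := by
    intro s hs s' hs' t ht
    have := dist_le_of_trajectories_ODE (v := fun _ => F) (fun _ => hF)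
      (fun t ht => (hγ s hs t ht).continuousWithinAt)
      (fun t ht => (hγ s hs t ⟨ht.1, ht.2.le⟩).Ici_of_Icc ht)
      (fun t ht => (hγ s' hs' t ht).continuousWithinAt)
      (fun t ht => (hγ s' hs' t ⟨ht.1, ht.2.le⟩).Ici_of_Icc ht) le_rfl t ht
    refine this.trans ?_
    gcongr
    linarith [ht.2]
  rintro ⟨s₀, t₀⟩ ⟨hs₀, ht₀⟩
  have hs₀ : s₀ ∈ S := hs₀
  have ht₀ : t₀ ∈ Icc 0 T := ht₀
  rw [ContinuousWithinAt, tendsto_iff_dist_tendsto_zero]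
  have hfst : Filter.Tendsto (fun z : ℝ × ℝ => z.1)
      (nhdsWithin (s₀, t₀) (S ×ˢ Icc 0 T)) (nhdsWithin s₀ S) :=
    tendsto_nhdsWithin_iff.2 ⟨(continuous_fst.tendsto _).mono_left nhdsWithin_le_nhds,
      eventually_mem_nhdsWithin.mono fun z hz => hz.1⟩
  have hsnd : Filter.Tendsto (fun z : ℝ × ℝ => z.2)
      (nhdsWithin (s₀, t₀) (S ×ˢ Icc 0 T)) (nhdsWithin t₀ (Icc 0 T)) :=
    tendsto_nhdsWithin_iff.2 ⟨(continuous_snd.tendsto _).mono_left nhdsWithin_le_nhds,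
      eventually_mem_nhdsWithin.mono fun z hz => hz.2⟩
  have l1 := (tendsto_iff_dist_tendsto_zero.1 ((h0 s₀ hs₀).tendsto.comp hfst)).mul_const
    (Real.exp (K * T))
  have l2 := tendsto_iff_dist_tendsto_zero.1
    ((hγ s₀ hs₀ t₀ ht₀).continuousWithinAt.tendsto.comp hsnd)
  have l3 := l1.add l2
  rw [zero_mul, zero_add] at l3
  refine squeeze_zero' (Filter.Eventually.of_forall fun _ => dist_nonneg) ?_ l3
  filter_upwards [eventually_mem_nhdsWithin] with z hz
  exact (dist_triangle _ (γ s₀ z.2) _).trans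
    (add_le_add (hgr z.1 hz.1 s₀ hs₀ z.2 hz.2) le_rfl)

/-- If a continuous family of functions on `[t₁, t₂]`, positive at both endpoints, passes from a
function which takes a nonpositive value to a nonnegative function, then some member of the
family is nonnegative and vanishes at an interior point. -/
lemma exists_touching_parameter {a b t₁ t₂ : ℝ} (hab : a ≤ b) {f : ℝ → ℝ → ℝ}
    (hf : ContinuousOn (fun z : ℝ × ℝ => f z.1 z.2) (Icc a b ×ˢ Icc t₁ t₂))
    (h1 : ∀ s ∈ Icc a b, 0 < f s t₁) (h2 : ∀ s ∈ Icc a b, 0 < f s t₂)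
    (ha : ∃ t ∈ Icc t₁ t₂, f a t ≤ 0) (hb : ∀ t ∈ Icc t₁ t₂, 0 ≤ f b t) :
    ∃ s ∈ Icc a b, ∃ t ∈ Ioo t₁ t₂, f s t = 0 ∧ ∀ t' ∈ Icc t₁ t₂, 0 ≤ f s t' := by
  have hK : IsCompact (Icc a b ×ˢ Icc t₁ t₂ : Set (ℝ × ℝ)) := isCompact_Icc.prod isCompact_Icc
  set A : Set ℝ := Prod.fst '' ((Icc a b ×ˢ Icc t₁ t₂) ∩ (fun z : ℝ × ℝ => f z.1 z.2) ⁻¹' Iic 0)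
    with hA
  set B : Set ℝ := ⋂ t ∈ Icc t₁ t₂, (Icc a b ∩ (fun s => f s t) ⁻¹' Ici 0) with hB
  have hAc : IsClosed A :=
    ((hK.of_isClosed_subset (hf.preimage_isClosed_of_isClosed hK.isClosed isClosed_Iic)
      inter_subset_left).image continuous_fst).isClosed
  have hBc : IsClosed B := by
    refine isClosed_biInter fun t ht => ?_
    refine ContinuousOn.preimage_isClosed_of_isClosed ?_ isClosed_Icc isClosed_Ici
    exact hf.comp (f := fun s : ℝ => (s, t)) (by fun_prop) fun s hs => ⟨hs, ht⟩
  obtain ⟨t₀, ht₀, hat₀⟩ := ha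
  have hcover : Icc a b ⊆ A ∪ B := by
    intro s hs
    by_cases h : ∃ t ∈ Icc t₁ t₂, f s t ≤ 0
    · obtain ⟨t, ht, hst⟩ := h
      exact Or.inl ⟨(s, t), ⟨⟨hs, ht⟩, hst⟩, rfl⟩
    · push Not at h
      exact Or.inr (mem_iInter₂.2 fun t ht => ⟨hs, (h t ht).le⟩)
  obtain ⟨s, hs, hsA, hsB⟩ := isPreconnected_closed_iff.1 isPreconnected_Icc A B hAc hBc hcover
    ⟨a, ⟨le_rfl, hab⟩, ⟨(a, t₀), ⟨⟨⟨le_rfl, hab⟩, ht₀⟩, hat₀⟩, rfl⟩⟩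
    ⟨b, ⟨hab, le_rfl⟩, mem_iInter₂.2 fun t ht => ⟨⟨hab, le_rfl⟩, hb t ht⟩⟩
  obtain ⟨⟨s', t⟩, ⟨⟨-, ht⟩, hst⟩, rfl⟩ := hsA
  have hnn : ∀ t' ∈ Icc t₁ t₂, 0 ≤ f s' t' := fun t' ht' => (mem_iInter₂.1 hsB t' ht').2
  have ht : t ∈ Icc t₁ t₂ := ht
  have h0 : f s' t = 0 := le_antisymm hst (hnn t ht)
  refine ⟨s', hs, t, ⟨lt_of_le_of_ne ht.1 ?_, lt_of_le_of_ne ht.2 ?_⟩, h0, hnn⟩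
  · rintro rfl; exact (h1 s' hs).ne' h0
  · rintro rfl; exact (h2 s' hs).ne' h0

end Analysis

namespace DiskMetric

open Set Metric Filter Topology

variable {N : ℕ} {k : ℕ∞}

local notation "𝔼" => EuclideanSpace ℝ (Fin N)

/-! ### The geodesic vector field of a metric -/

lemma uniqueDiffOn_disk : UniqueDiffOn ℝ (disk N) :=
  uniqueDiffOn_convex (convex_closedBall _ _)
    ⟨0, ball_subset_interior_closedBall (mem_ball_self one_pos)⟩

lemma isCompact_disk : IsCompact (disk N) := isCompact_closedBall _ _

lemma form_injective (g : DiskMetric N k) {x : 𝔼} (hx : x ∈ disk N) :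
    Function.Injective (g.form x) :=
  (injective_iff_map_eq_zero (g.form x)).2 fun v hv => by
    by_contra hne
    have := g.pos x hx v hne
    simp [hv] at this

/-- The metric at `x`, as an isomorphism from vectors to covectors. -/
noncomputable def formEquiv (g : DiskMetric N k) {x : 𝔼} (hx : x ∈ disk N) :
    𝔼 ≃L[ℝ] (𝔼 →L[ℝ] ℝ) :=
  ContinuousLinearEquiv.ofBijective (g.form x) (LinearMap.ker_eq_bot.2 (g.form_injective hx))
    (LinearMap.range_eq_top.2 <| (LinearMap.injective_iff_surjective_of_finrank_eq_finrank (by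
      rw [← (LinearMap.toContinuousLinearMap (𝕜 := ℝ) (E := 𝔼) (F' := ℝ)).finrank_eq]
      exact (Subspace.dual_finrank_eq (K := ℝ) (V := 𝔼)).symm)).1 (g.form_injective hx))

lemma coe_formEquiv (g : DiskMetric N k) {x : 𝔼} (hx : x ∈ disk N) :
    (g.formEquiv hx : 𝔼 →L[ℝ] (𝔼 →L[ℝ] ℝ)) = g.form x := rfl

lemma form_inverse_apply (g : DiskMetric N k) {x : 𝔼} (hx : x ∈ disk N) (ξ : 𝔼 →L[ℝ] ℝ) :
    g.form x ((g.form x).inverse ξ) = ξ := by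
  rw [← g.coe_formEquiv hx, ContinuousLinearMap.inverse_equiv]
  exact (g.formEquiv hx).apply_symm_apply ξ

lemma contDiffOn_inverse (g : DiskMetric N k) {n : WithTop ℕ∞} (hn : n ≤ k) :
    ContDiffOn ℝ n (fun x => (g.form x).inverse) (disk N) := fun x hx =>
  ContDiffAt.comp_contDiffWithinAt (g := ContinuousLinearMap.inverse) x
    (by rw [← g.coe_formEquiv hx]; exact contDiffAt_map_inverse _)
    ((g.contDiffOn.of_le hn) x hx)

/-- The covector `w ↦ Γ_x(v, v; w)`. -/
noncomputable def christoffelCovector (g : DiskMetric N k) (x v : 𝔼) : 𝔼 →L[ℝ] ℝ :=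
  fderivWithin ℝ g.form (disk N) x v v
    - (1 / 2 : ℝ) • ((fderivWithin ℝ g.form (disk N) x).flip v).flip v

lemma christoffelCovector_apply (g : DiskMetric N k) (x v w : 𝔼) :
    g.christoffelCovector x v w = g.christoffel x v v w := by
  simp [christoffelCovector, christoffel]
  ring

/-- The acceleration of a geodesic which passes through `x` with velocity `v`. -/
noncomputable def accel (g : DiskMetric N k) (x v : 𝔼) : 𝔼 :=
  -(g.form x).inverse (g.christoffelCovector x v)

/-- The inward `g`-normal of the sphere at `x`, normalized by `g (normal, w) = -2 ⟪x, w⟫`, that is,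
the `g`-gradient of `x ↦ 1 - ‖x‖ ^ 2`. -/
noncomputable def inwardNormal (g : DiskMetric N k) (x : 𝔼) : 𝔼 :=
  (g.form x).inverse ((-2 : ℝ) • innerSL ℝ x)

lemma form_accel (g : DiskMetric N k) {x : 𝔼} (hx : x ∈ disk N) (v : 𝔼) :
    g.form x (g.accel x v) = -g.christoffelCovector x v := by
  rw [accel, map_neg, g.form_inverse_apply hx]

lemma form_inwardNormal (g : DiskMetric N k) {x : 𝔼} (hx : x ∈ disk N) :
    g.form x (g.inwardNormal x) = (-2 : ℝ) • innerSL ℝ x :=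
  g.form_inverse_apply hx _

lemma contDiffOn_fderivWithin_form (g : DiskMetric N k) (hk : 2 ≤ k) :
    ContDiffOn ℝ 1 (fderivWithin ℝ g.form (disk N)) (disk N) :=
  g.contDiffOn.fderivWithin uniqueDiffOn_disk
    (by rw [one_add_one_eq_two]; exact WithTop.coe_le_coe.2 hk)

lemma contDiffOn_accel (g : DiskMetric N k) (hk : 2 ≤ k) :
    ContDiffOn ℝ 1 (fun z : 𝔼 × 𝔼 => g.accel z.1 z.2) (disk N ×ˢ univ) := by
  have hfst : MapsTo (Prod.fst : 𝔼 × 𝔼 → 𝔼) (disk N ×ˢ univ) (disk N) := fun z hz => hz.1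
  have hD := (g.contDiffOn_fderivWithin_form hk).comp contDiffOn_fst hfst
  have hI := (g.contDiffOn_inverse (n := 1) (by exact_mod_cast (one_le_two.trans hk))).comp
    contDiffOn_fst hfst
  have hv : ContDiffOn ℝ 1 (Prod.snd : 𝔼 × 𝔼 → 𝔼) (disk N ×ˢ univ) := contDiffOn_snd
  have hF1 := (ContinuousLinearMap.flipₗᵢ ℝ 𝔼 𝔼 (𝔼 →L[ℝ] ℝ)).contDiff.comp_contDiffOn hD
  have hF2 := (ContinuousLinearMap.flipₗᵢ ℝ 𝔼 𝔼 ℝ).contDiff.comp_contDiffOn (hF1.clm_apply hv)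
  exact (hI.clm_apply (((hD.clm_apply hv).clm_apply hv).sub
    ((hF2.clm_apply hv).const_smul (1 / 2 : ℝ)))).neg

lemma continuousOn_inwardNormal (g : DiskMetric N k) :
    ContinuousOn g.inwardNormal (disk N) :=
  ((g.contDiffOn_inverse (n := 0) (by simp)).continuousOn).clm_apply
    (((innerSL ℝ (E := 𝔼)).continuous.const_smul (-2 : ℝ)).continuousOn)

/-- The geodesic vector field `(x, v) ↦ (v, accel x v)` of `g` on the product of the disk and the
ball of radius `R`, extended to all of phase space by the radial retractions onto these balls. The
extension is bounded and Lipschitz, and its integral curves are geodesics as long as they stay in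
the two balls. -/
noncomputable def geodesicField (g : DiskMetric N k) (R : ℝ) (z : 𝔼 × 𝔼) : 𝔼 × 𝔼 :=
  (radialRetraction R z.2, g.accel (radialRetraction 1 z.1) (radialRetraction R z.2))

lemma radialRetraction_mem_disk (x : 𝔼) : radialRetraction 1 x ∈ disk N :=
  mem_closedBall_zero_iff.2 (norm_radialRetraction_le one_pos x)

lemma geodesicField_of_mem (g : DiskMetric N k) {R : ℝ} (hR : 0 < R) {z : 𝔼 × 𝔼}
    (hx : z.1 ∈ disk N) (hv : ‖z.2‖ ≤ R) : g.geodesicField R z = (z.2, g.accel z.1 z.2) := by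
  rw [geodesicField, radialRetraction_of_norm_le hR hv,
    radialRetraction_of_norm_le one_pos (mem_closedBall_zero_iff.1 hx)]

lemma exists_lipschitzWith_geodesicField (g : DiskMetric N k) (hk : 2 ≤ k) {R : ℝ} (hR : 0 < R) :
    ∃ K, LipschitzWith K (g.geodesicField R) := by
  have hc : IsCompact (disk N ×ˢ closedBall (0 : 𝔼) R) :=
    isCompact_disk.prod (isCompact_closedBall _ _)
  have hconv : Convex ℝ (disk N ×ˢ closedBall (0 : 𝔼) R) :=
    (convex_closedBall _ _).prod (convex_closedBall _ _)
  obtain ⟨K, hK⟩ := ((g.contDiffOn_accel hk).mono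
    (prod_mono_right (subset_univ (closedBall (0 : 𝔼) R)))).exists_lipschitzOnWith
      one_ne_zero hconv hc
  have h1 : LipschitzWith (2 * 1) fun z : 𝔼 × 𝔼 => radialRetraction (1 : ℝ) z.1 :=
    (lipschitzWith_radialRetraction one_pos).comp LipschitzWith.prod_fst
  have h2 : LipschitzWith (2 * 1) fun z : 𝔼 × 𝔼 => radialRetraction R z.2 :=
    (lipschitzWith_radialRetraction hR).comp LipschitzWith.prod_snd
  have h3 := hK.comp (h1.prodMk h2).lipschitzOnWith (s := univ) fun z _ =>
    ⟨radialRetraction_mem_disk z.1, mem_closedBall_zero_iff.2 (norm_radialRetraction_le hR z.2)⟩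
  exact ⟨_, h2.prodMk (lipschitzOnWith_univ.1 h3)⟩

lemma exists_norm_accel_le (g : DiskMetric N k) (hk : 2 ≤ k) (R : ℝ) :
    ∃ M, ∀ x ∈ disk N, ∀ v : 𝔼, ‖v‖ ≤ R → ‖g.accel x v‖ ≤ M := by
  have hc : IsCompact (disk N ×ˢ closedBall (0 : 𝔼) R) :=
    isCompact_disk.prod (isCompact_closedBall _ _)
  obtain ⟨M, hM⟩ := hc.exists_bound_of_continuousOn ((g.contDiffOn_accel hk).continuousOn.mono
    (prod_mono_right (subset_univ (closedBall (0 : 𝔼) R))))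
  exact ⟨M, fun x hx v hv => hM (x, v) ⟨hx, mem_closedBall_zero_iff.2 hv⟩⟩

lemma exists_norm_geodesicField_le (g : DiskMetric N k) (hk : 2 ≤ k) {R : ℝ} (hR : 0 < R) :
    ∃ M, ∀ z, ‖g.geodesicField R z‖ ≤ M := by
  obtain ⟨M, hM⟩ := g.exists_norm_accel_le hk R
  refine ⟨max R M, fun z => norm_prod_le_iff.2 ⟨?_, ?_⟩⟩
  · exact le_max_of_le_left (norm_radialRetraction_le hR _)
  · exact le_max_of_le_right
      (hM _ (radialRetraction_mem_disk _) _ (norm_radialRetraction_le hR _))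

/-- An integral curve of the extended geodesic field is a geodesic as long as it stays in the disk
and its velocity stays in the ball of radius `R`. -/
lemma isGeodesicSegment_of_integralCurve (g : DiskMetric N k) (hk : 2 ≤ k) {R b : ℝ} (hR : 0 < R)
    (hb : 0 < b) {z : ℝ → 𝔼 × 𝔼}
    (hz : ∀ t ∈ Icc 0 b, HasDerivWithinAt z (g.geodesicField R (z t)) (Icc 0 b) t)
    (hx : ∀ t ∈ Icc 0 b, (z t).1 ∈ disk N) (hv : ∀ t ∈ Icc 0 b, ‖(z t).2‖ ≤ R) :
    g.IsGeodesicSegment b (fun t => (z t).1) ∧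
      ∀ t ∈ Icc 0 b, derivWithin (fun t => (z t).1) (Icc 0 b) t = (z t).2 := by
  have hu : UniqueDiffOn ℝ (Icc 0 b) := uniqueDiffOn_Icc hb
  have h1 : ∀ t ∈ Icc 0 b, HasDerivWithinAt (fun t => (z t).1) (z t).2 (Icc 0 b) t := by
    intro t ht
    have := (hz t ht).fst
    rwa [g.geodesicField_of_mem hR (hx t ht) (hv t ht)] at this
  have h2 : ∀ t ∈ Icc 0 b,
      HasDerivWithinAt (fun t => (z t).2) (g.accel (z t).1 (z t).2) (Icc 0 b) t := by
    intro t ht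
    have := (hz t ht).snd
    rwa [g.geodesicField_of_mem hR (hx t ht) (hv t ht)] at this
  have d1 : EqOn (derivWithin (fun t => (z t).1) (Icc 0 b)) (fun t => (z t).2) (Icc 0 b) :=
    fun t ht => (h1 t ht).derivWithin (hu t ht)
  have d2 : EqOn (derivWithin (derivWithin (fun t => (z t).1) (Icc 0 b)) (Icc 0 b))
      (fun t => g.accel (z t).1 (z t).2) (Icc 0 b) := fun t ht => by
    rw [derivWithin_congr d1 (d1 ht)]
    exact (h2 t ht).derivWithin (hu t ht)
  have hzc : ContinuousOn z (Icc 0 b) := fun t ht => (hz t ht).continuousWithinAt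
  have hac : ContinuousOn (fun t => g.accel (z t).1 (z t).2) (Icc 0 b) :=
    (g.contDiffOn_accel hk).continuousOn.comp hzc fun t ht => ⟨hx t ht, mem_univ _⟩
  have c1 : ContDiffOn ℝ 1 (fun t => (z t).2) (Icc 0 b) := by
    have : ContDiffOn ℝ (0 + 1) (fun t => (z t).2) (Icc 0 b) := by
      rw [contDiffOn_succ_iff_derivWithin hu]
      refine ⟨fun t ht => (h2 t ht).differentiableWithinAt, by simp, ?_⟩
      rw [contDiffOn_zero]
      exact hac.congr fun t ht => (h2 t ht).derivWithin (hu t ht)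
    simpa using this
  refine ⟨⟨hb, ?_, hx, fun t ht w => ?_⟩, d1⟩
  · have : ContDiffOn ℝ (1 + 1) (fun t => (z t).1) (Icc 0 b) := by
      rw [contDiffOn_succ_iff_derivWithin hu]
      exact ⟨fun t ht => (h1 t ht).differentiableWithinAt, by simp, c1.congr d1⟩
    simpa [one_add_one_eq_two] using this
  · rw [d2 ht, d1 ht, ← g.christoffelCovector_apply, g.form_accel (hx t ht)]
    simp

/-! ### Stability of the geodesic vector field in the `C^2` topology -/

lemma eventually_iteratedFDerivWithin_dist_lt (g₀ : DiskMetric N k) (j : Fin 3) {ε : ℝ}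
    (hε : 0 < ε) : ∀ᶠ g in 𝓝 g₀, ∀ x : disk N,
      dist (iteratedFDerivWithin ℝ (j : ℕ) g₀.form (disk N) x)
        (iteratedFDerivWithin ℝ (j : ℕ) g.form (disk N) x) < ε := by
  have hc : Continuous (fun g : DiskMetric N k => UniformFun.ofFun fun x : disk N =>
      iteratedFDerivWithin ℝ (j : ℕ) g.form (disk N) x) :=
    continuous_iInf_dom (i := j) continuous_induced_dom
  have h := UniformFun.tendsto_iff_tendstoUniformly.1 (hc.tendsto g₀)
  exact Metric.tendstoUniformly_iff.1 h ε hε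

/-- Metrics near `g₀` are uniformly `C^1`-close to `g₀`. -/
lemma eventually_norm_sub_le (g₀ : DiskMetric N k) {ε : ℝ} (hε : 0 < ε) :
    ∀ᶠ g in 𝓝 g₀, ∀ x ∈ disk N, ‖g.form x - g₀.form x‖ ≤ ε ∧
      ‖fderivWithin ℝ g.form (disk N) x - fderivWithin ℝ g₀.form (disk N) x‖ ≤ ε := by
  filter_upwards [g₀.eventually_iteratedFDerivWithin_dist_lt 0 hε,
    g₀.eventually_iteratedFDerivWithin_dist_lt 1 hε] with g h0 h1 x hx
  have h0 : dist (iteratedFDerivWithin ℝ 0 g₀.form (disk N) x)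
      (iteratedFDerivWithin ℝ 0 g.form (disk N) x) < ε := h0 ⟨x, hx⟩
  have h1 : dist (iteratedFDerivWithin ℝ 1 g₀.form (disk N) x)
      (iteratedFDerivWithin ℝ 1 g.form (disk N) x) < ε := h1 ⟨x, hx⟩
  rw [dist_comm, dist_eq_norm] at h0 h1
  constructor
  · have := (iteratedFDerivWithin ℝ 0 g.form (disk N) x
      - iteratedFDerivWithin ℝ 0 g₀.form (disk N) x).le_opNorm 0
    simp only [sub_apply, iteratedFDerivWithin_zero_apply,
      Finset.univ_eq_empty, Finset.prod_empty, mul_one] at this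
    exact this.trans h0.le
  · refine ContinuousLinearMap.opNorm_le_bound _ hε.le fun u => ?_
    have := (iteratedFDerivWithin ℝ 1 g.form (disk N) x
      - iteratedFDerivWithin ℝ 1 g₀.form (disk N) x).le_opNorm fun _ => u
    simp only [sub_apply,
      iteratedFDerivWithin_one_apply (uniqueDiffOn_disk x hx), Finset.univ_unique,
      Finset.prod_singleton] at this
    exact this.trans (by gcongr)

/-- A metric on the disk is uniformly positive definite. -/
lemma exists_coercive (g : DiskMetric N k) :
    ∃ m > 0, ∀ x ∈ disk N, ∀ v, m * ‖v‖ ^ 2 ≤ g.form x v v := by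
  have hK : IsCompact (disk N ×ˢ sphere (0 : 𝔼) 1) := isCompact_disk.prod (isCompact_sphere _ _)
  have hc : ContinuousOn (fun z : 𝔼 × 𝔼 => g.form z.1 z.2 z.2) (disk N ×ˢ sphere (0 : 𝔼) 1) :=
    ((g.contDiffOn.continuousOn.comp continuousOn_fst fun z hz => hz.1).clm_apply
      continuousOn_snd).clm_apply continuousOn_snd
  obtain ⟨m, hm, h⟩ := hK.exists_forall_le' hc (a := 0) fun z hz =>
    g.pos z.1 hz.1 z.2 (ne_of_mem_sphere hz.2 one_ne_zero)
  refine ⟨m, hm, fun x hx v => ?_⟩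
  rcases eq_or_ne v 0 with rfl | hv
  · simp
  have hv' : 0 < ‖v‖ := norm_pos_iff.2 hv
  have h1 := h (x, ‖v‖⁻¹ • v) ⟨hx, by simp [norm_smul, hv'.ne']⟩
  simp only [map_smul, smul_apply, smul_eq_mul] at h1
  calc m * ‖v‖ ^ 2 ≤ (‖v‖⁻¹ * (‖v‖⁻¹ * g.form x v v)) * ‖v‖ ^ 2 := by gcongr
    _ = g.form x v v := by field_simp

/-- Solutions of the linear equations `G a = ξ` and `G₀ a₀ = ξ₀` are close if the data are and
`G₀` is coercive. -/
lemma norm_sub_le_of_coercive {V : Type*} [NormedAddCommGroup V] [NormedSpace ℝ V]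
    {G G₀ : V →L[ℝ] V →L[ℝ] ℝ} {ξ ξ₀ : V →L[ℝ] ℝ} {a a₀ : V} {m δ C : ℝ} (hm : 0 < m)
    (hcoer : ∀ v, m * ‖v‖ ^ 2 ≤ G₀ v v) (ha : G a = ξ) (ha₀ : G₀ a₀ = ξ₀) (hδ : 2 * δ ≤ m)
    (hG : ‖G - G₀‖ ≤ δ) (hξ : ‖ξ - ξ₀‖ ≤ δ * C) :
    ‖a - a₀‖ ≤ 2 * δ / m * (C + ‖a₀‖) := by
  have hδ0 : 0 ≤ δ := (norm_nonneg _).trans hG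
  have e : G₀ (a - a₀) (a - a₀) = (ξ - ξ₀) (a - a₀) - (G - G₀) a (a - a₀) := by
    rw [← ha, ← ha₀]
    simp only [map_sub, sub_apply]
    ring
  have h1 : (ξ - ξ₀) (a - a₀) ≤ δ * C * ‖a - a₀‖ :=
    (le_abs_self _).trans ((ξ - ξ₀).le_of_opNorm_le hξ _)
  have h2 : -((G - G₀) a (a - a₀)) ≤ δ * ‖a‖ * ‖a - a₀‖ :=
    (neg_le_abs _).trans (((G - G₀).le_opNorm₂ a (a - a₀)).trans (by gcongr))
  have h3 := hcoer (a - a₀)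
  have h4 : ‖a‖ ≤ ‖a - a₀‖ + ‖a₀‖ := by simpa using norm_add_le (a - a₀) a₀
  rcases (norm_nonneg (a - a₀)).eq_or_lt with h0 | h0
  · rw [← h0]
    have hC : 0 ≤ δ * C := (norm_nonneg _).trans hξ
    have : 2 * δ / m * (C + ‖a₀‖) = 2 / m * (δ * C + δ * ‖a₀‖) := by ring
    rw [this]
    positivity
  have h5 : m * ‖a - a₀‖ ≤ δ * C + δ * ‖a‖ := by
    refine le_of_mul_le_mul_right ?_ h0
    linarith [e ▸ h3]
  have h6 : δ * ‖a‖ ≤ δ * (‖a - a₀‖ + ‖a₀‖) := by gcongr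
  have h7 : 2 * δ * ‖a - a₀‖ ≤ m * ‖a - a₀‖ := by gcongr
  rw [div_mul_eq_mul_div, le_div_iff₀ hm]
  linarith

lemma norm_christoffelCovector_sub_le (g g₀ : DiskMetric N k) {δ : ℝ} {x : 𝔼}
    (h : ‖fderivWithin ℝ g.form (disk N) x - fderivWithin ℝ g₀.form (disk N) x‖ ≤ δ) (v : 𝔼) :
    ‖g.christoffelCovector x v - g₀.christoffelCovector x v‖ ≤ δ * (2 * ‖v‖ ^ 2) := by
  have hδ0 : 0 ≤ δ := (norm_nonneg _).trans h
  refine ContinuousLinearMap.opNorm_le_bound _ (by positivity) fun w => ?_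
  set D := fderivWithin ℝ g.form (disk N) x - fderivWithin ℝ g₀.form (disk N) x with hD
  have e : (g.christoffelCovector x v - g₀.christoffelCovector x v) w
      = D v v w - 1 / 2 * D w v v := by
    simp [christoffelCovector, hD]
    ring
  have h3 : ∀ a b c, ‖D a b c‖ ≤ δ * ‖a‖ * ‖b‖ * ‖c‖ := fun a b c =>
    ((D a).le_opNorm₂ b c).trans (by gcongr; exact D.le_of_opNorm_le h a)
  rw [e]
  refine (norm_sub_le _ _).trans ?_
  rw [norm_mul]
  have h1 := h3 v v w
  have h2 := h3 w v v
  have h4 : ‖(1 / 2 : ℝ)‖ = 1 / 2 := by norm_num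
  rw [h4]
  nlinarith [norm_nonneg (D w v v)]

/-- The geodesic field and the inward normal of a metric depend continuously on the metric,
uniformly over phase space, respectively over the disk. -/
lemma eventually_geodesicField_dist_le (g₀ : DiskMetric N k) (hk : 2 ≤ k) {R ε : ℝ} (hR : 0 < R)
    (hε : 0 < ε) : ∀ᶠ g in 𝓝 g₀,
      (∀ z, dist (g.geodesicField R z) (g₀.geodesicField R z) ≤ ε) ∧
        ∀ x ∈ disk N, dist (g.inwardNormal x) (g₀.inwardNormal x) ≤ ε := by
  obtain ⟨m, hm, hcoer⟩ := g₀.exists_coercive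
  obtain ⟨A, hA⟩ := g₀.exists_norm_accel_le hk R
  obtain ⟨B, hB⟩ := isCompact_disk.exists_bound_of_continuousOn g₀.continuousOn_inwardNormal
  set C := 2 * R ^ 2 + |A| + |B| + 1 with hC
  have hC0 : 0 < C := by positivity
  -- Coercivity turns an error `δ ≤ m / 2` of the metric into an error `2 * δ / m * C` of the field.
  have hδ : 0 < min (m / 2) (ε * m / (2 * C)) := by positivity
  filter_upwards [g₀.eventually_norm_sub_le hδ] with g hg
  set δ := min (m / 2) (ε * m / (2 * C))
  have hδm : 2 * δ ≤ m := by linarith [min_le_left (m / 2) (ε * m / (2 * C))]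
  have hδε : 2 * δ / m * C ≤ ε := by
    have : δ * (2 * C) ≤ ε * m := (le_div_iff₀ (by positivity)).1 (min_le_right _ _)
    rw [div_mul_eq_mul_div, div_le_iff₀ hm]
    linarith
  constructor
  · intro z
    have hx := radialRetraction_mem_disk z.1
    have hv := norm_radialRetraction_le hR z.2
    rw [geodesicField, geodesicField, Prod.dist_eq, dist_self, max_eq_right dist_nonneg,
      dist_eq_norm]
    refine (norm_sub_le_of_coercive hm (hcoer _ hx) (g.form_accel hx _) (g₀.form_accel hx _) hδm
      (hg _ hx).1 (C := 2 * R ^ 2) ?_).trans (le_trans ?_ hδε)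
    · rw [← neg_sub', norm_neg]
      refine (norm_christoffelCovector_sub_le g g₀ (hg _ hx).2 _).trans ?_
      gcongr
    · gcongr
      linarith [hA _ hx _ hv, le_abs_self A, abs_nonneg B]
  · intro x hx
    rw [dist_eq_norm]
    refine (norm_sub_le_of_coercive hm (hcoer _ hx) (g.form_inwardNormal hx)
      (g₀.form_inwardNormal hx) hδm (hg _ hx).1 (C := 0) (by simp)).trans (le_trans ?_ hδε)
    gcongr
    nlinarith [hB _ hx, le_abs_self B, abs_nonneg A, sq_nonneg R]

/-- Finite-time continuous dependence: for `g` near `g₀`, integral curves of the geodesic field of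
`g` which start along the inward normal at a point of the disk stay close to the corresponding
integral curves of `g₀`. -/
lemma eventually_integralCurve_dist_le (g₀ : DiskMetric N k) (hk : 2 ≤ k) {R ε T : ℝ} (hR : 0 < R)
    (hε : 0 < ε) : ∀ᶠ g in 𝓝 g₀, ∀ p ∈ disk N, ∀ z z₀ : ℝ → 𝔼 × 𝔼,
      z 0 = (p, g.inwardNormal p) → z₀ 0 = (p, g₀.inwardNormal p) →
      (∀ t ∈ Icc 0 T, HasDerivWithinAt z (g.geodesicField R (z t)) (Icc 0 T) t) →
      (∀ t ∈ Icc 0 T, HasDerivWithinAt z₀ (g₀.geodesicField R (z₀ t)) (Icc 0 T) t) →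
      ∀ t ∈ Icc 0 T, dist (z t) (z₀ t) ≤ ε := by
  obtain ⟨K, hK⟩ := g₀.exists_lipschitzWith_geodesicField hk hR
  set M := 2 * Real.exp ((K + 1 : ℝ) * |T|) with hM
  have hM0 : 0 < M := by positivity
  -- The larger constant `K + 1` keeps the Lipschitz constant away from `0`.
  have hK1 : LipschitzWith (K + 1) (g₀.geodesicField R) := hK.weaken (by simp)
  have hη : 0 < ε / M := by positivity
  filter_upwards [g₀.eventually_geodesicField_dist_le hk hR hη] with g hg
    p hp z z₀ h0 h00 hz hz₀ t ht
  have hgr := dist_le_of_approx_trajectories_ODE (v := fun _ => g₀.geodesicField R)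
    (f := z) (g := z₀) (εf := ε / M) (εg := 0) (δ := ε / M) (fun _ => hK1)
    (fun t ht => (hz t ht).continuousWithinAt)
    (fun t ht => (hz t ⟨ht.1, ht.2.le⟩).Ici_of_Icc ht) (fun t _ => hg.1 (z t))
    (fun t ht => (hz₀ t ht).continuousWithinAt)
    (fun t ht => (hz₀ t ⟨ht.1, ht.2.le⟩).Ici_of_Icc ht) (fun t _ => (dist_self _).le)
    (by
      rw [h0, h00, Prod.dist_eq, dist_self, max_eq_right dist_nonneg]
      exact hg.2 p hp) t ht
  refine hgr.trans ?_
  have hK2 : ((K + 1 : NNReal) : ℝ) ≠ 0 := by positivity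
  rw [gronwallBound_of_K_ne_0 hK2, add_zero, sub_zero, NNReal.coe_add, NNReal.coe_one]
  have h1 : Real.exp ((K + 1 : ℝ) * t) ≤ Real.exp ((K + 1 : ℝ) * |T|) := by
    gcongr
    exact ht.2.trans (le_abs_self T)
  have h2 : ε / M / (K + 1 : ℝ) ≤ ε / M := div_le_self hη.le (by simp)
  have h3 : 1 ≤ Real.exp ((K + 1 : ℝ) * t) := Real.one_le_exp (mul_nonneg (by positivity) ht.1)
  calc ε / M * Real.exp ((K + 1 : ℝ) * t)
        + ε / M / (K + 1 : ℝ) * (Real.exp ((K + 1 : ℝ) * t) - 1)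
      ≤ ε / M * Real.exp ((K + 1 : ℝ) * t) + ε / M * Real.exp ((K + 1 : ℝ) * t) := by
        gcongr
        linarith
    _ = ε / M * (2 * Real.exp ((K + 1 : ℝ) * t)) := by ring
    _ ≤ ε / M * M := mul_le_mul_of_nonneg_left (by linarith) hη.le
    _ = ε := div_mul_cancel₀ ε hM0.ne'

/-! ### The sheared flat metric and its parabolic geodesics -/

/-- The vector of the coordinate plane of `i` and `j` with coordinates `a` and `b`. -/
noncomputable def planeVec (i j : Fin N) (a b : ℝ) : 𝔼 :=
  a • EuclideanSpace.single i 1 + b • EuclideanSpace.single j 1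

lemma planeVec_apply_left {i j : Fin N} (hij : i ≠ j) (a b : ℝ) : planeVec i j a b i = a := by
  simp [planeVec, hij]

lemma planeVec_apply_right {i j : Fin N} (hij : i ≠ j) (a b : ℝ) : planeVec i j a b j = b := by
  simp [planeVec, hij.symm]

lemma inner_planeVec_left (i j : Fin N) (a b : ℝ) (w : 𝔼) :
    inner ℝ (planeVec i j a b) w = a * w i + b * w j := by
  simp [planeVec, inner_add_left, inner_smul_left, EuclideanSpace.inner_single_left]

lemma norm_planeVec_sq {i j : Fin N} (hij : i ≠ j) (a b : ℝ) :
    ‖planeVec i j a b‖ ^ 2 = a ^ 2 + b ^ 2 := by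
  rw [← real_inner_self_eq_norm_sq, inner_planeVec_left, planeVec_apply_left hij,
    planeVec_apply_right hij]
  ring

lemma norm_planeVec_le (i j : Fin N) (a b : ℝ) : ‖planeVec i j a b‖ ≤ |a| + |b| :=
  (norm_add_le _ _).trans (by simp [norm_smul])

lemma hasDerivAt_planeVec (i j : Fin N) {a b : ℝ → ℝ} {a' b' t : ℝ} (ha : HasDerivAt a a' t)
    (hb : HasDerivAt b b' t) :
    HasDerivAt (fun t => planeVec i j (a t) (b t)) (planeVec i j a' b') t :=
  (ha.smul_const _).add (hb.smul_const _)

/-- The pullback of the flat metric `∑ dy_l ^ 2 + dy_i ^ 2` under the shear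
`x ↦ x + x_i ^ 2 e_j`, as a form on all of `ℝ^N`. -/
noncomputable def shearForm (i j : Fin N) (x : 𝔼) : 𝔼 →L[ℝ] 𝔼 →L[ℝ] ℝ :=
  let ℓ : Fin N → 𝔼 →L[ℝ] ℝ := EuclideanSpace.proj
  (∑ l, (ℓ l).smulRight (ℓ l) + (ℓ i).smulRight (ℓ i))
    + (2 * ℓ i x) • ((ℓ i).smulRight (ℓ j) + (ℓ j).smulRight (ℓ i))
    + (4 * ℓ i x ^ 2) • (ℓ i).smulRight (ℓ i)

lemma shearForm_apply (i j : Fin N) (x v w : 𝔼) :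
    shearForm i j x v w = inner ℝ v w + v i * w i + 2 * x i * (v i * w j + v j * w i)
      + 4 * x i ^ 2 * (v i * w i) := by
  simp [shearForm, PiLp.inner_apply, mul_comm, mul_add]

lemma contDiff_shearForm (i j : Fin N) {n : WithTop ℕ∞} : ContDiff ℝ n (shearForm i j) := by
  unfold shearForm
  fun_prop

lemma fderiv_shearForm_apply (i j : Fin N) (x u v w : 𝔼) :
    fderiv ℝ (shearForm i j) x u v w = 2 * u i * (v i * w j + v j * w i)
      + 8 * x i * u i * (v i * w i) := by
  let ℓ : Fin N → 𝔼 →L[ℝ] ℝ := EuclideanSpace.proj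
  have h1 := (((ℓ i).hasFDerivAt (x := x)).const_mul 2).smul_const
    ((ℓ i).smulRight (ℓ j) + (ℓ j).smulRight (ℓ i))
  have h2 := ((((ℓ i).hasFDerivAt (x := x)).pow 2).const_mul 4).smul_const
    ((ℓ i).smulRight (ℓ i))
  have h : HasFDerivAt (shearForm i j) _ x :=
    (h1.const_add (∑ l, (ℓ l).smulRight (ℓ l) + (ℓ i).smulRight (ℓ i))).add h2
  rw [h.fderiv]
  simp [ℓ]
  ring

lemma sq_add_sq_le_norm_sq {i j : Fin N} (hij : i ≠ j) (v : 𝔼) : v i ^ 2 + v j ^ 2 ≤ ‖v‖ ^ 2 := by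
  rw [EuclideanSpace.real_norm_sq_eq, ← Finset.sum_pair (f := fun l => v l ^ 2) hij]
  exact Finset.sum_le_sum_of_subset_of_nonneg (Finset.subset_univ _) fun _ _ _ => sq_nonneg _

/-- The restriction of `shearForm` to the disk, as a Riemannian metric. -/
noncomputable def shearMetric {i j : Fin N} (hij : i ≠ j) (k : ℕ∞) : DiskMetric N k where
  form := (disk N).indicator (shearForm i j)
  contDiffOn := (contDiff_shearForm i j).contDiffOn.congr fun x hx => indicator_of_mem hx _
  symm x hx v w := by
    rw [indicator_of_mem hx, shearForm_apply, shearForm_apply, real_inner_comm]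
    ring
  pos x hx v hv := by
    rw [indicator_of_mem hx, shearForm_apply, real_inner_self_eq_norm_sq]
    have h1 := sq_add_sq_le_norm_sq hij v
    have h2 : 0 < ‖v‖ ^ 2 := by positivity
    have e : ‖v‖ ^ 2 + v i * v i + 2 * x i * (v i * v j + v j * v i) + 4 * x i ^ 2 * (v i * v i)
        = (‖v‖ ^ 2 - (v i ^ 2 + v j ^ 2)) + 2 * v i ^ 2 + (v j + 2 * x i * v i) ^ 2 := by ring
    rw [e]
    rcases eq_or_ne (v i) 0 with h0 | h0
    · rw [h0]
      nlinarith
    · have : 0 < v i ^ 2 := by positivity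
      nlinarith [sq_nonneg (v j + 2 * x i * v i)]
  eq_zero x hx := indicator_of_notMem hx _

variable {i j : Fin N} (hij : i ≠ j)

lemma shearMetric_form_apply {x : 𝔼} (hx : x ∈ disk N) (v w : 𝔼) :
    (shearMetric hij k).form x v w = inner ℝ v w + v i * w i
      + 2 * x i * (v i * w j + v j * w i) + 4 * x i ^ 2 * (v i * w i) := by
  rw [← shearForm_apply]
  simp only [shearMetric, indicator_of_mem hx]

lemma fderivWithin_shearMetric_form_apply {x : 𝔼} (hx : x ∈ disk N) (u v w : 𝔼) :
    fderivWithin ℝ (shearMetric hij k).form (disk N) x u v w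
      = 2 * u i * (v i * w j + v j * w i) + 8 * x i * u i * (v i * w i) := by
  have h : fderivWithin ℝ (shearMetric hij k).form (disk N) x
      = fderivWithin ℝ (shearForm i j) (disk N) x :=
    fderivWithin_congr (fun y hy => indicator_of_mem hy _) (indicator_of_mem hx _)
  rw [h, fderivWithin_eq_fderiv (uniqueDiffOn_disk x hx)
    ((contDiff_shearForm i j (n := 1)).differentiable one_ne_zero x), fderiv_shearForm_apply]

lemma accel_shearMetric {x : 𝔼} (hx : x ∈ disk N) (v : 𝔼) :
    (shearMetric hij k).accel x v = planeVec i j 0 (-2 * v i ^ 2) := by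
  apply (shearMetric hij k).form_injective hx
  rw [form_accel _ hx]
  ext w
  rw [neg_apply, christoffelCovector_apply, christoffel,
    fderivWithin_shearMetric_form_apply hij hx, fderivWithin_shearMetric_form_apply hij hx,
    shearMetric_form_apply hij hx, inner_planeVec_left, planeVec_apply_left hij,
    planeVec_apply_right hij]
  ring

lemma inwardNormal_shearMetric {a b : ℝ} (hp : planeVec i j a b ∈ disk N) :
    (shearMetric hij k).inwardNormal (planeVec i j a b)
      = planeVec i j (-a * (1 - 2 * b)) (-2 * b + 2 * a ^ 2 * (1 - 2 * b)) := by
  apply (shearMetric hij k).form_injective hp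
  rw [form_inwardNormal _ hp]
  ext w
  rw [smul_apply, innerSL_apply_apply, shearMetric_form_apply hij hp, inner_planeVec_left,
    inner_planeVec_left, planeVec_apply_left hij, planeVec_apply_left hij,
    planeVec_apply_right hij, smul_eq_mul]
  ring

/-- The geodesic of the sheared metric which starts at `planeVec i j a b` along the inward normal,
with its velocity: a parabola, which the shear straightens to a segment. -/
noncomputable def parabola (i j : Fin N) (a b t : ℝ) : 𝔼 × 𝔼 :=
  (planeVec i j (a * (1 - t * (1 - 2 * b)))
      (b + a ^ 2 - 2 * b * t - a ^ 2 * (1 - t * (1 - 2 * b)) ^ 2),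
    planeVec i j (-a * (1 - 2 * b))
      (-2 * b + 2 * a ^ 2 * (1 - t * (1 - 2 * b)) * (1 - 2 * b)))

lemma parabola_zero {i j : Fin N} (hij : i ≠ j) (k : ℕ∞) {a b : ℝ}
    (hp : planeVec i j a b ∈ disk N) :
    parabola i j a b 0
      = (planeVec i j a b, (shearMetric hij k).inwardNormal (planeVec i j a b)) := by
  rw [inwardNormal_shearMetric hij hp, parabola]
  congr 2 <;> ring

lemma hasDerivAt_parabola (k : ℕ∞) {R a b t : ℝ} (hR : 0 < R)
    (hv : ‖(parabola i j a b t).2‖ ≤ R) :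
    HasDerivAt (parabola i j a b)
      ((shearMetric hij k).geodesicField R (parabola i j a b t)) t := by
  rw [geodesicField, accel_shearMetric hij (radialRetraction_mem_disk _),
    radialRetraction_of_norm_le hR hv]
  have h0 : HasDerivAt (fun t : ℝ => 1 - t * (1 - 2 * b)) (-(1 * (1 - 2 * b))) t :=
    ((hasDerivAt_id t).mul_const (1 - 2 * b)).const_sub 1
  refine HasDerivAt.prodMk ?_ ?_
  · refine hasDerivAt_planeVec i j ?_ ?_
    · exact (h0.const_mul a).congr_deriv (by ring)
    · refine ((((hasDerivAt_id t).const_mul (2 * b)).const_sub (b + a ^ 2)).sub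
        ((h0.pow 2).const_mul (a ^ 2))).congr_deriv ?_
      simp only [Nat.cast_ofNat]
      ring
  · refine hasDerivAt_planeVec i j (hasDerivAt_const _ _) ?_
    refine (((h0.const_mul (2 * a ^ 2)).mul_const (1 - 2 * b)).const_add (-2 * b)).congr_deriv ?_
    simp only [parabola, planeVec_apply_left hij]
    ring

/-! ### Estimates for the parabolas -/

/-- The point of the sphere with second coordinate `s` on the left half of the circle in the
coordinate plane of `i` and `j`, for `|s| ≤ 1`. -/
noncomputable def startPoint (i j : Fin N) (s : ℝ) : 𝔼 := planeVec i j (-√(1 - s ^ 2)) s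

lemma continuous_startPoint (i j : Fin N) : Continuous (startPoint i j) := by
  unfold startPoint planeVec
  fun_prop

lemma norm_startPoint {i j : Fin N} (hij : i ≠ j) {s : ℝ} (hs : s ^ 2 ≤ 1) :
    ‖startPoint i j s‖ = 1 := by
  have h := norm_planeVec_sq hij (-√(1 - s ^ 2)) s
  rw [neg_sq, Real.sq_sqrt (by linarith), sub_add_cancel] at h
  exact (pow_eq_one_iff_of_nonneg (norm_nonneg _) two_ne_zero).1 h

/-- The model geodesic starting at `startPoint i j s`, with its velocity. -/
noncomputable def modelCurve (i j : Fin N) (s t : ℝ) : 𝔼 × 𝔼 := parabola i j (-√(1 - s ^ 2)) s t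

/-- `1 - ‖x‖ ^ 2` along the model geodesics. -/
def modelHeight (s t : ℝ) : ℝ :=
  1 - (1 - s ^ 2) * (1 - t * (1 - 2 * s)) ^ 2
    - (1 - (1 - s ^ 2) * (1 - t * (1 - 2 * s)) ^ 2 + s * (1 - s - 2 * t)) ^ 2

lemma modelHeight_eq {i j : Fin N} (hij : i ≠ j) {s : ℝ} (hs : s ^ 2 ≤ 1) (t : ℝ) :
    1 - ‖(modelCurve i j s t).1‖ ^ 2 = modelHeight s t := by
  have h := Real.sq_sqrt (show 0 ≤ 1 - s ^ 2 by linarith)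
  rw [modelCurve, parabola, norm_planeVec_sq hij, mul_pow, neg_sq, h, modelHeight]
  ring

lemma norm_modelCurve_le (i j : Fin N) {s t : ℝ} (hs : s ∈ Icc (-1 / 50 : ℝ) (1 / 50))
    (ht : t ∈ Icc (0 : ℝ) (3 / 2)) :
    ‖(modelCurve i j s t).1‖ ≤ 4 ∧ ‖(modelCurve i j s t).2‖ ≤ 4 := by
  obtain ⟨hs1, hs2⟩ := hs
  obtain ⟨ht1, ht2⟩ := ht
  have hss : s ^ 2 ≤ 1 := by nlinarith
  have h := Real.sq_sqrt (show 0 ≤ 1 - s ^ 2 by linarith)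
  have hC0 := Real.sqrt_nonneg (1 - s ^ 2)
  have hC1 : √(1 - s ^ 2) ≤ 1 := Real.sqrt_le_one.2 (by nlinarith)
  set C := √(1 - s ^ 2)
  have hst1 : -3 / 100 ≤ s * t := by nlinarith
  have hst2 : s * t ≤ 3 / 100 := by nlinarith
  set z := 1 - t * (1 - 2 * s) with hz
  have hz1 : -1 ≤ z := by rw [hz]; nlinarith
  have hz2 : z ≤ 11 / 10 := by rw [hz]; nlinarith
  have hzz : z ^ 2 ≤ 5 / 4 := by nlinarith
  have hCz : C ^ 2 * z ^ 2 ≤ 5 / 4 := by nlinarith [sq_nonneg z]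
  have hCz0 : 0 ≤ C ^ 2 * z ^ 2 := by positivity
  constructor
  · refine (norm_planeVec_le i j _ _).trans ?_
    have h1 : |(-C) * z| ≤ 2 := by
      rw [abs_le]
      constructor <;> nlinarith
    have h2 : |s + (-C) ^ 2 - 2 * s * t - (-C) ^ 2 * z ^ 2| ≤ 2 := by
      rw [neg_sq, abs_le]
      constructor <;> nlinarith
    linarith
  · refine (norm_planeVec_le i j _ _).trans ?_
    have h1 : |-(-C) * (1 - 2 * s)| ≤ 11 / 10 := by
      rw [abs_le]
      constructor <;> nlinarith
    have h3 : |2 * (-C) ^ 2 * z * (1 - 2 * s)| ≤ 2 * 1 * (11 / 10) * (26 / 25) := by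
      rw [neg_sq, abs_mul, abs_mul, abs_mul]
      gcongr
      · norm_num
      · rw [abs_le]; constructor <;> nlinarith
      · rw [abs_le]; constructor <;> linarith
      · rw [abs_le]; constructor <;> linarith
    have h2 := abs_add_le (-2 * s) (2 * (-C) ^ 2 * z * (1 - 2 * s))
    have h4 : |-2 * s| ≤ 1 / 25 := by rw [abs_le]; constructor <;> linarith
    linarith

/-- The model geodesics enter the disk at a definite rate. -/
lemma inner_modelCurve_le {i j : Fin N} (hij : i ≠ j) {s t : ℝ}
    (hs : s ∈ Icc (-1 / 50 : ℝ) (1 / 50)) (ht : t ∈ Icc (0 : ℝ) (1 / 10)) :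
    inner ℝ (modelCurve i j s t).1 (modelCurve i j s t).2 ≤ -1 / 10 := by
  obtain ⟨hs1, hs2⟩ := hs
  obtain ⟨ht1, ht2⟩ := ht
  have hss : s ^ 2 ≤ 1 / 2500 := by nlinarith
  have h := Real.sq_sqrt (show 0 ≤ 1 - s ^ 2 by linarith)
  rw [modelCurve, parabola, inner_planeVec_left, planeVec_apply_left hij,
    planeVec_apply_right hij, neg_sq, h]
  have hst1 : -1 / 500 ≤ s * t := by nlinarith
  have hst2 : s * t ≤ 1 / 500 := by nlinarith
  set z := 1 - t * (1 - 2 * s) with hz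
  have hz1 : 89 / 100 ≤ z := by rw [hz]; nlinarith
  have hz2 : z ≤ 1 := by rw [hz]; nlinarith
  set m := (1 - s ^ 2) * z * (1 - 2 * s) with hm
  have hz3 : 88 / 100 ≤ (1 - s ^ 2) * z := by nlinarith [sq_nonneg s]
  have hz4 : (1 - s ^ 2) * z ≤ 1 := by nlinarith [sq_nonneg s]
  have hm1 : 84 / 100 ≤ m := by rw [hm]; nlinarith
  have hm2 : m ≤ 104 / 100 := by rw [hm]; nlinarith
  have hq : 78 / 100 ≤ (1 - s ^ 2) * z ^ 2 := by nlinarith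
  have hq2 : (1 - s ^ 2) * z ^ 2 ≤ 1 := by nlinarith
  set y := s + (1 - s ^ 2) - 2 * s * t - (1 - s ^ 2) * z ^ 2 with hy
  have hy1 : y ≤ 1 / 4 := by rw [hy]; nlinarith
  have hy2 : -1 / 10 ≤ y := by rw [hy]; nlinarith
  have e : (-√(1 - s ^ 2)) * z * (-(-√(1 - s ^ 2)) * (1 - 2 * s)) = -m := by
    rw [hm]; linear_combination (-(z * (1 - 2 * s))) * h
  have e2 : 2 * (1 - s ^ 2) * z * (1 - 2 * s) = 2 * m := by rw [hm]; ring
  rw [e, e2]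
  nlinarith

lemma modelHeight_pos_of_le_half {s t : ℝ} (hs : s ∈ Icc (-1 / 50 : ℝ) (1 / 50))
    (ht : t ∈ Icc (1 / 10 : ℝ) (1 / 2)) : 1 / 100 ≤ modelHeight s t := by
  obtain ⟨hs1, hs2⟩ := hs
  obtain ⟨ht1, ht2⟩ := ht
  have hss : s ^ 2 ≤ 1 / 2500 := by nlinarith
  set z := 1 - t * (1 - 2 * s) with hz
  have hst1 : -1 / 100 ≤ s * t := by nlinarith
  have hst2 : s * t ≤ 1 / 100 := by nlinarith
  have hz1 : 47 / 100 ≤ z := by rw [hz]; nlinarith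
  have hz2 : z ≤ 92 / 100 := by rw [hz]; nlinarith
  set y := 1 - (1 - s ^ 2) * z ^ 2 with hy
  have hy1 : 15 / 100 ≤ y := by rw [hy]; nlinarith [sq_nonneg s, sq_nonneg z]
  have hy2 : y ≤ 80 / 100 := by rw [hy]; nlinarith
  set e := s * (1 - s - 2 * t) with he
  have he1 : -3 / 100 ≤ e := by rw [he]; nlinarith
  have he2 : e ≤ 3 / 100 := by rw [he]; nlinarith
  have : modelHeight s t = y - (y + e) ^ 2 := by rw [modelHeight, hy, he, hz]
  rw [this]
  nlinarith

lemma modelHeight_pos_end {s : ℝ} (hs : s ∈ Icc (-1 / 50 : ℝ) (1 / 50)) :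
    1 / 100 ≤ modelHeight s (3 / 2) := by
  obtain ⟨hs1, hs2⟩ := hs
  have hss : s ^ 2 ≤ 1 / 2500 := by nlinarith
  set z := 1 - 3 / 2 * (1 - 2 * s) with hz
  have hz1 : -56 / 100 ≤ z := by rw [hz]; linarith
  have hz2 : z ≤ -44 / 100 := by rw [hz]; linarith
  set y := 1 - (1 - s ^ 2) * z ^ 2 with hy
  have hy1 : 68 / 100 ≤ y := by rw [hy]; nlinarith [sq_nonneg s, sq_nonneg z]
  have hy2 : y ≤ 81 / 100 := by rw [hy]; nlinarith
  set e := s * (1 - s - 2 * (3 / 2)) with he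
  have he1 : -5 / 100 ≤ e := by rw [he]; nlinarith
  have he2 : e ≤ 5 / 100 := by rw [he]; nlinarith
  have : modelHeight s (3 / 2) = y - (y + e) ^ 2 := by rw [modelHeight, hy, he, hz]
  rw [this]
  nlinarith

/-- The model geodesic that starts at the lower end of the arc leaves the disk. -/
lemma modelHeight_neg : modelHeight (-1 / 50) 1 ≤ -1 / 100 := by
  norm_num [modelHeight]

/-- The model geodesic that starts at the upper end of the arc stays inside the disk. -/
lemma modelHeight_pos_top {t : ℝ} (ht : t ∈ Icc (1 / 2 : ℝ) (3 / 2)) :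
    1 / 100 ≤ modelHeight (1 / 50) t := by
  obtain ⟨ht1, ht2⟩ := ht
  set z := 1 - t * (1 - 2 * (1 / 50)) with hz
  set q := (1 - (1 / 50) ^ 2) * z ^ 2 with hq
  set e := 1 / 50 * (1 - 1 / 50 - 2 * t) with he
  have : modelHeight (1 / 50) t = (1 - q) * q - e * (2 * (1 - q) + e) := by
    rw [modelHeight, hq, he, hz]; ring
  rw [this]
  have he1 : -41 / 1000 ≤ e := by rw [he]; linarith
  have he2 : e ≤ 0 := by rw [he]; linarith
  rcases le_total t (3 / 4) with h | h
  -- Early on the point is still far from the vertex, so that `q` is not small.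
  · have hz1 : 28 / 100 ≤ z := by rw [hz]; linarith
    have hz2 : z ≤ 52 / 100 := by rw [hz]; linarith
    have hq1 : 7 / 100 ≤ q := by rw [hq]; nlinarith
    have hq2 : q ≤ 28 / 100 := by rw [hq]; nlinarith
    nlinarith
  · have hz1 : -44 / 100 ≤ z := by rw [hz]; linarith
    have hz2 : z ≤ 28 / 100 := by rw [hz]; linarith
    have hq1 : 0 ≤ q := by rw [hq]; positivity
    have hq2 : q ≤ 20 / 100 := by rw [hq]; nlinarith
    have he3 : e ≤ -1 / 100 := by rw [he]; linarith
    nlinarith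

/-! ### Chords of the perturbed metrics -/

lemma abs_norm_sq_sub_le {V : Type*} [NormedAddCommGroup V] [InnerProductSpace ℝ V] {x x₀ : V}
    {ε B : ℝ} (hε : ε ≤ 1) (h : ‖x - x₀‖ ≤ ε) (hB : ‖x₀‖ ≤ B) :
    |‖x‖ ^ 2 - ‖x₀‖ ^ 2| ≤ ε * (2 * B + 1) := by
  have h1 := (abs_norm_sub_norm_le x x₀).trans h
  have h0 := norm_nonneg x₀
  have h2 := norm_nonneg x
  have e : ‖x‖ ^ 2 - ‖x₀‖ ^ 2 = (‖x‖ - ‖x₀‖) * (‖x‖ + ‖x₀‖) := by ring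
  rw [e, abs_mul, abs_of_nonneg (by positivity : 0 ≤ ‖x‖ + ‖x₀‖)]
  have h3 := (abs_le.1 h1).2
  have : 0 ≤ ε := (norm_nonneg _).trans h
  exact mul_le_mul h1 (by linarith) (by positivity) this

lemma inner_sub_inner_le {V : Type*} [NormedAddCommGroup V] [InnerProductSpace ℝ V]
    {x x₀ v v₀ : V} {ε B : ℝ} (hε : ε ≤ 1) (hx : ‖x - x₀‖ ≤ ε) (hv : ‖v - v₀‖ ≤ ε)
    (hxB : ‖x₀‖ ≤ B) (hvB : ‖v₀‖ ≤ B) :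
    inner ℝ x v - inner ℝ x₀ v₀ ≤ ε * (2 * B + 1) := by
  have e : inner ℝ x v - inner ℝ x₀ v₀
      = inner ℝ (x - x₀) (v - v₀) + inner ℝ (x - x₀) v₀ + inner ℝ x₀ (v - v₀) := by
    simp only [inner_sub_left, inner_sub_right]
    ring
  have hε0 : 0 ≤ ε := (norm_nonneg _).trans hx
  have hB : 0 ≤ B := (norm_nonneg _).trans hxB
  have h1 : inner ℝ (x - x₀) (v - v₀) ≤ ε * 1 :=
    (real_inner_le_norm _ _).trans (mul_le_mul hx (hv.trans hε) (norm_nonneg _) hε0)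
  have h2 : inner ℝ (x - x₀) v₀ ≤ ε * B :=
    (real_inner_le_norm _ _).trans (mul_le_mul hx hvB (norm_nonneg _) hε0)
  have h3 : inner ℝ x₀ (v - v₀) ≤ B * ε :=
    (real_inner_le_norm _ _).trans (mul_le_mul hxB hv (norm_nonneg _) hB)
  rw [e]
  linarith

/-- A geodesic which leaves the sphere along the inward normal, and which stays in the disk until
it meets the sphere with zero radial velocity, is an orthogonal-tangent chord. -/
lemma isOTChord_of_integralCurve (g : DiskMetric N k) (hk : 2 ≤ k) {R b : ℝ} (hR : 0 < R)
    (hb : 0 < b) {p : 𝔼} (hp : ‖p‖ = 1) {z : ℝ → 𝔼 × 𝔼} (h0 : z 0 = (p, g.inwardNormal p))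
    (hz : ∀ t ∈ Icc 0 b, HasDerivWithinAt z (g.geodesicField R (z t)) (Icc 0 b) t)
    (hx : ∀ t ∈ Icc 0 b, ‖(z t).1‖ ≤ 1) (hv : ∀ t ∈ Icc 0 b, ‖(z t).2‖ ≤ R)
    (hend : ‖(z b).1‖ = 1) (htan : inner ℝ (z b).1 (z b).2 = 0) :
    g.IsOTChord b (fun t => (z t).1) := by
  have hpd : p ∈ disk N := mem_closedBall_zero_iff.2 hp.le
  obtain ⟨hgeo, hder⟩ := g.isGeodesicSegment_of_integralCurve hk hR hb hz
    (fun t ht => mem_closedBall_zero_iff.2 (hx t ht)) hv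
  have hder0 : derivWithin (fun t => (z t).1) (Icc 0 b) 0 = g.inwardNormal p := by
    rw [hder 0 ⟨le_rfl, hb.le⟩, h0]
  have hform : ∀ w, g.form p (g.inwardNormal p) w = -2 * inner ℝ p w := fun w => by
    simp [g.form_inwardNormal hpd]
  refine ⟨hgeo, ?_, ?_, mem_sphere_zero_iff_norm.2 hend, fun w hw => ?_, ?_⟩
  · rw [hder0]
    intro h
    have := hform p
    rw [h, real_inner_self_eq_norm_sq, hp] at this
    norm_num at this
  · rw [h0]
    exact mem_sphere_zero_iff_norm.2 hp
  · rw [hder0]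
    simp only [h0] at hw ⊢
    rw [hform, hw, mul_zero]
  · rw [hder b ⟨hb.le, le_rfl⟩]
    exact htan

/-- A metric whose normal geodesics from the arc `startPoint` are close to the model parabolas
admits an orthogonal-tangent chord: by continuity, some geodesic of the family touches the sphere
from inside. -/
lemma admitsOTChord_of_dist_modelCurve_le (g : DiskMetric N k) (hk : 2 ≤ k) {i j : Fin N}
    (hij : i ≠ j) {z : ℝ → ℝ → 𝔼 × 𝔼}
    (h0 : ∀ s, z s 0 = (startPoint i j s, g.inwardNormal (startPoint i j s)))
    (hz : ∀ s, ∀ t ∈ Icc (0 : ℝ) (3 / 2),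
      HasDerivWithinAt (z s) (g.geodesicField 5 (z s t)) (Icc 0 (3 / 2)) t)
    (hclose : ∀ s ∈ Icc (-1 / 50 : ℝ) (1 / 50), ∀ t ∈ Icc (0 : ℝ) (3 / 2),
      dist (z s t) (modelCurve i j s t) ≤ 1 / 1000) : g.AdmitsOTChord := by
  have hs2 : ∀ s ∈ Icc (-1 / 50 : ℝ) (1 / 50), s ^ 2 ≤ 1 := fun s hs => by
    nlinarith [hs.1, hs.2]
  have hc : ∀ s ∈ Icc (-1 / 50 : ℝ) (1 / 50), ∀ t ∈ Icc (0 : ℝ) (3 / 2),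
      ‖(z s t).1 - (modelCurve i j s t).1‖ ≤ 1 / 1000 ∧
        ‖(z s t).2 - (modelCurve i j s t).2‖ ≤ 1 / 1000 := fun s hs t ht => by
    have := hclose s hs t ht
    rwa [dist_eq_norm, norm_prod_le_iff] at this
  have hv : ∀ s ∈ Icc (-1 / 50 : ℝ) (1 / 50), ∀ t ∈ Icc (0 : ℝ) (3 / 2), ‖(z s t).2‖ ≤ 5 :=
    fun s hs t ht => by
      have h1 := norm_add_le ((z s t).2 - (modelCurve i j s t).2) (modelCurve i j s t).2
      rw [sub_add_cancel] at h1
      linarith [(hc s hs t ht).2, (norm_modelCurve_le i j hs ht).2]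
  set F : ℝ → ℝ → ℝ := fun s t => 1 - ‖(z s t).1‖ ^ 2 with hF
  -- The closeness `1 / 1000` is chosen so that the height changes by less than `1 / 100`, the margin
  -- in the estimates for `modelHeight`.
  have hFm : ∀ s ∈ Icc (-1 / 50 : ℝ) (1 / 50), ∀ t ∈ Icc (0 : ℝ) (3 / 2),
      |F s t - modelHeight s t| < 1 / 100 := fun s hs t ht => by
    have h1 := abs_norm_sq_sub_le (by norm_num) (hc s hs t ht).1 (norm_modelCurve_le i j hs ht).1
    have e : F s t - modelHeight s t = -(‖(z s t).1‖ ^ 2 - ‖(modelCurve i j s t).1‖ ^ 2) := by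
      rw [hF, ← modelHeight_eq hij (hs2 s hs)]
      ring
    rw [e, abs_neg]
    linarith
  have hderiv : ∀ s ∈ Icc (-1 / 50 : ℝ) (1 / 50), ∀ t ∈ Icc (0 : ℝ) (3 / 2),
      HasDerivWithinAt (F s) (-(2 * inner ℝ (z s t).1 (z s t).2)) (Icc 0 (3 / 2)) t :=
    fun s hs t ht => by
      have h1 := (hz s t ht).fst
      rw [geodesicField, radialRetraction_of_norm_le (by norm_num) (hv s hs t ht)] at h1
      have h2 : HasDerivWithinAt (fun t => (z s t).1) (z s t).2 (Icc 0 (3 / 2)) t := h1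
      exact h2.norm_sq.const_sub 1
  have hF0 : ∀ s ∈ Icc (-1 / 50 : ℝ) (1 / 50), F s 0 = 0 := fun s hs => by
    simp [hF, h0, norm_startPoint hij (hs2 s hs)]
  -- Near the start the height increases.
  have hstart : ∀ s ∈ Icc (-1 / 50 : ℝ) (1 / 50), ∀ t ∈ Icc (0 : ℝ) (1 / 10), 0 ≤ F s t := by
    intro s hs t ht
    have hsub : Icc (0 : ℝ) (1 / 10) ⊆ Icc 0 (3 / 2) := Icc_subset_Icc_right (by norm_num)
    have hmono : MonotoneOn (F s) (Icc 0 (1 / 10)) := by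
      refine monotoneOn_of_hasDerivWithinAt_nonneg (convex_Icc _ _)
        (fun t ht => ((hderiv s hs t (hsub ht)).continuousWithinAt).mono hsub)
        (fun t ht => (hderiv s hs t (hsub (interior_subset ht))).mono
          (interior_subset.trans hsub)) fun t ht => ?_
      have ht := interior_subset ht
      have h1 := inner_sub_inner_le (by norm_num) (hc s hs t (hsub ht)).1 (hc s hs t (hsub ht)).2
        (norm_modelCurve_le i j hs (hsub ht)).1 (norm_modelCurve_le i j hs (hsub ht)).2
      linarith [inner_modelCurve_le hij hs ht]
    rw [← hF0 s hs]
    exact hmono ⟨le_rfl, by norm_num⟩ ht ht.1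
  have hmid : ∀ s ∈ Icc (-1 / 50 : ℝ) (1 / 50), ∀ t ∈ Icc (1 / 10 : ℝ) (1 / 2), 0 < F s t :=
    fun s hs t ht => by
      have h1 := abs_lt.1 (hFm s hs t ⟨by linarith [ht.1], by linarith [ht.2]⟩)
      linarith [modelHeight_pos_of_le_half hs ht]
  obtain ⟨K, hK⟩ := g.exists_lipschitzWith_geodesicField hk (R := 5) (by norm_num)
  have hcont : ContinuousOn (fun x : ℝ × ℝ => F x.1 x.2)
      (Icc (-1 / 50) (1 / 50) ×ˢ Icc (1 / 2) (3 / 2)) := by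
    have h1 : ContinuousOn (fun s => z s 0) (Icc (-1 / 50 : ℝ) (1 / 50)) := by
      simp only [h0]
      refine (continuous_startPoint i j).continuousOn.prodMk
        (g.continuousOn_inwardNormal.comp (continuous_startPoint i j).continuousOn fun s hs => ?_)
      exact mem_closedBall_zero_iff.2 (norm_startPoint hij (hs2 s hs)).le
    have h2 := continuousOn_uncurry_of_integralCurves hK (fun s _ => hz s) h1
    exact continuousOn_const.sub ((h2.mono (prod_mono_right
      (Icc_subset_Icc_left (by norm_num)))).fst.norm.pow 2)
  obtain ⟨s, hs, b, hb, hFb, hnn⟩ := exists_touching_parameter (f := F) (by norm_num) hcont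
    (fun s hs => hmid s hs _ ⟨by norm_num, le_rfl⟩)
    (fun s hs => by
      have h1 := abs_lt.1 (hFm s hs (3 / 2) ⟨by norm_num, le_rfl⟩)
      linarith [modelHeight_pos_end hs])
    ⟨1, ⟨by norm_num, by norm_num⟩, by
      have h1 := abs_lt.1 (hFm (-1 / 50) ⟨le_rfl, by norm_num⟩ 1 ⟨by norm_num, by norm_num⟩)
      linarith [modelHeight_neg]⟩
    (fun t ht => by
      have h1 := abs_lt.1 (hFm (1 / 50) ⟨by norm_num, le_rfl⟩ t ⟨by linarith [ht.1], ht.2⟩)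
      linarith [modelHeight_pos_top ht])
  have hb0 : 0 < b := lt_trans (by norm_num) hb.1
  have hsub : Icc 0 b ⊆ Icc 0 (3 / 2) := Icc_subset_Icc_right hb.2.le
  have hbI : b ∈ Icc (0 : ℝ) (3 / 2) := ⟨hb0.le, hb.2.le⟩
  have hpos : ∀ t ∈ Icc 0 b, 0 ≤ F s t := fun t ht => by
    rcases le_total t (1 / 10) with h | h
    · exact hstart s hs t ⟨ht.1, h⟩
    rcases le_total t (1 / 2) with h' | h'
    · exact (hmid s hs t ⟨h, h'⟩).le
    · exact hnn t ⟨h', ht.2.trans hb.2.le⟩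
  have hmin : IsLocalMin (F s) b := by
    filter_upwards [Icc_mem_nhds hb.1 hb.2] with t ht
    rw [hFb]
    exact hnn t ht
  have htan : inner ℝ (z s b).1 (z s b).2 = 0 := by
    have := hmin.hasDerivAt_eq_zero ((hderiv s hs b hbI).hasDerivAt (Icc_mem_nhds hb0 hb.2))
    linarith
  refine ⟨b, _, g.isOTChord_of_integralCurve hk (R := 5) (by norm_num) hb0
    (norm_startPoint hij (hs2 s hs)) (h0 s) (fun t ht => (hz s t (hsub ht)).mono hsub)
    (fun t ht => ?_) (fun t ht => hv s hs t (hsub ht)) ?_ htan⟩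
  · have := hpos t ht
    rw [hF] at this
    exact (sq_le_one_iff₀ (norm_nonneg _)).1 (by linarith)
  · refine (pow_eq_one_iff_of_nonneg (norm_nonneg (z s b).1) two_ne_zero).1 ?_
    rw [hF] at hFb
    linarith

lemma eventually_admitsOTChord_shearMetric {i j : Fin N} (hij : i ≠ j) (hk : 2 ≤ k) :
    ∀ᶠ g in 𝓝 (shearMetric hij k), g.AdmitsOTChord := by
  filter_upwards [(shearMetric hij k).eventually_integralCurve_dist_le hk (R := 5)
    (ε := 1 / 1000) (T := 3 / 2) (by norm_num) (by norm_num)] with g hg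
  obtain ⟨K, hK⟩ := g.exists_lipschitzWith_geodesicField hk (R := 5) (by norm_num)
  obtain ⟨M, hM⟩ := g.exists_norm_geodesicField_le hk (R := 5) (by norm_num)
  choose z h0 hz using fun s : ℝ => exists_hasDerivWithinAt_Icc_of_bounded hK hM
    (T := 3 / 2) (by norm_num) (startPoint i j s, g.inwardNormal (startPoint i j s))
  refine g.admitsOTChord_of_dist_modelCurve_le hk hij h0 hz fun s hs => ?_
  have hp : startPoint i j s ∈ disk N :=
    mem_closedBall_zero_iff.2 (norm_startPoint hij (by nlinarith [hs.1, hs.2])).le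
  refine hg _ hp _ _ (h0 s) (parabola_zero hij k hp) (hz s) fun t ht => ?_
  refine (hasDerivAt_parabola hij k (by norm_num) ?_).hasDerivWithinAt
  exact (norm_modelCurve_le i j hs ht).2.trans (by norm_num)

end DiskMetric

theorem corollaryA4 (N : ℕ) (hN : 2 ≤ N) (k : ℕ∞) (hk : 2 ≤ k) :
    (interior {g : DiskMetric N k | g.AdmitsOTChord}).Nonempty ∧
      ¬ Dense {g : DiskMetric N k | ¬ g.AdmitsOTChord} := by
  have hij : (⟨0, by omega⟩ : Fin N) ≠ ⟨1, by omega⟩ := by simp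
  have hint : (interior {g : DiskMetric N k | g.AdmitsOTChord}).Nonempty :=
    ⟨_, mem_interior_iff_mem_nhds.2 (DiskMetric.eventually_admitsOTChord_shearMetric hij hk)⟩
  exact ⟨hint, fun h => hint.ne_empty (interior_eq_empty_iff_dense_compl.2 h)⟩
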